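/- Let $G=\prod_{k=0}^{\infty} Z_2$ be the dyadic group with normalized Haar measure $\mu$, $I_n(x)=\{y\in G: y_i=x_i \text{ for } 0\le i<n\}$ the dyadic intervals, $r_k(x)=(-1)^{x_k}$ the Rademacher functions and $w_n=\prod_k r_k^{n_k}$, for $n=\sum_k n_k2^k$ with $n_k\in\{0,1\}$, the Walsh functions. For a real martingale $F=(F_n)_{n\in\mathbb N}$ with respect to the $\sigma$-algebras $\zeta_n$ generated by $\{I_n(x):x\in G\}$ put $\widehat F(k)=\lim_{n\to\infty}\int_G F_nw_k\,d\mu$, $S_nF=\sum_{k=0}^{n-1}\widehat F(k)w_k$ and $\|F\|_{H_p}=\|\sup_n|F_n|\|_p$; $H_p(G)$ consists of the martingales with $\|F\|_{H_p}<\infty$. For $f\in L_1(G)$ put $\widehat f(k)=\int_G fw_k\,d\mu$, $S_nf=\sum_{k=0}^{n-1}\widehat f(k)w_k$ and $\|f\|_{H_p}=\|f^*\|_p$ with $f^*(x)=\sup_n \mu(I_n(x))^{-1}\left|\int_{I_n(x)}f\,d\mu\right|$. Put $\|g\|_{\text{weak-}L_p}^p=\sup_{\lambda>0}\lambda^p\mu(|g|>\lambda)$.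 A $p$-atom is a bounded measurable function $a$ for which there is a dyadic interval $I$ with $\int_I a\,d\mu=0$, $\|a\|_\infty\le\mu(I)^{-1/p}$ and $\operatorname{supp}a\subset I$. Let $0<p<1$. a) There is a constant $c_p$, depending only on $p$, such that for every $F\in H_p(G)$ $$\left\|\sup_{n\in\mathbb N}\frac{|S_{2^n+1}F|}{2^{n(1/p-1)}}\right\|_{\text{weak-}L_p}\le c_p\|F\|_{H_p}.$$ b) (Sharpness) Let $\varphi:\mathbb N\to[1,\infty)$ be a nondecreasing function such that $$\limsup_{n\to\infty}\frac{2^{n(1/p-1)}}{\varphi(2^n+1)}=\infty.$$ Then there is a sequence $(f_n)_{n\in\mathbb N}$ of $p$-atoms with $0<\|f_n\|_{H_p}<\infty$ such that $$\sup_{n\in\mathbb N}\frac{\left\|\dfrac{S_{2^n+1}f_n}{\varphi(2^n+1)}\right\|_{\text{weak-}L_p}}{\|f_n\|_{H_p}}=\infty.$$ -/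

import Mathlib

open MeasureTheory Filter
open scoped ENNReal NNReal

noncomputable section

namespace WalshHardy

/-- The dyadic (Walsh) group `G`: the complete direct product of countably many copies of the
cyclic group of order two, with coordinatewise addition. -/
abbrev G : Type := ℕ → ZMod 2

/-- The normalized Haar measure on `G`: the product of the measures giving mass `1/2` to
each of the two points of the cyclic group of order two. -/
def haar : Measure G :=
  Measure.infinitePi (fun _ : ℕ => ProbabilityTheory.uniformOn (Set.univ : Set (ZMod 2)))

/-- The dyadic interval `I_n(x)` of the points that agree with `x` in the first `n` coordinates. -/
def interval (n : ℕ) (x : G) : Set G := {y | ∀ i < n, y i = x i}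

lemma measurableSet_interval (n : ℕ) (x : G) : MeasurableSet (interval n x) := by
  have h : interval n x = ⋂ i, ⋂ (_ : i < n), {y : G | y i = x i} := by
    ext y; simp [interval]
  rw [h]
  refine MeasurableSet.iInter fun i => MeasurableSet.iInter fun _ => ?_
  exact measurableSet_eq_fun (measurable_pi_apply i) measurable_const

lemma finite_range_interval (n : ℕ) : (Set.range (interval n)).Finite := by
  have h : Set.range (interval n) ⊆
      Set.range (fun (z : Fin n → ZMod 2) => {y : G | ∀ i : Fin n, y i = z i}) := by
    rintro _ ⟨x, rfl⟩
    refine ⟨fun i => x i, ?_⟩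
    ext y
    exact ⟨fun hy i hi => hy ⟨i, hi⟩, fun hy i => hy i i.2⟩
  exact (Set.finite_range _).subset h

/-- The filtration of the `σ`-algebras generated by the dyadic intervals of each order. -/
def dyadicFiltration : Filtration ℕ (inferInstance : MeasurableSpace G) where
  seq n := MeasurableSpace.generateFrom (Set.range (interval n))
  mono' := by
    intro n m hnm
    refine MeasurableSpace.generateFrom_le ?_
    rintro _ ⟨x, rfl⟩
    have h : interval n x = ⋃₀ (interval m '' interval n x) := by
      ext y
      simp only [Set.mem_sUnion, Set.mem_image, exists_exists_and_eq_and]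
      constructor
      · exact fun hy => ⟨y, hy, fun _ _ => rfl⟩
      · rintro ⟨z, hz, hyz⟩ i hi
        rw [hyz i (hi.trans_le hnm), hz i hi]
    rw [h]
    refine MeasurableSet.sUnion
      ((finite_range_interval m).subset (Set.image_subset_range _ _)).countable ?_
    rintro _ ⟨z, -, rfl⟩
    exact MeasurableSpace.measurableSet_generateFrom ⟨z, rfl⟩
  le' n := by
    refine MeasurableSpace.generateFrom_le ?_
    rintro _ ⟨x, rfl⟩
    exact measurableSet_interval n x

/-- The Rademacher function `r_k(x) = (-1)^{x_k}`. -/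
def rademacher (k : ℕ) (x : G) : ℝ := (-1) ^ (x k).val

/-- The Walsh function `w_n = ∏_k r_k ^ {n_k}`, where `n = ∑_k n_k 2^k` is the binary expansion;
the digits of index at least `Nat.size n` vanish. -/
def walsh (n : ℕ) (x : G) : ℝ :=
  ∏ k ∈ Finset.range (Nat.size n), rademacher k x ^ (n.testBit k).toNat

/-- The `k`-th Walsh-Fourier coefficient of an integrable function. -/
def fourierCoeff (f : G → ℝ) (k : ℕ) : ℝ := ∫ x, f x * walsh k x ∂haar

/-- The `n`-th partial sum of the Walsh-Fourier series of an integrable function. -/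
def partialSum (n : ℕ) (f : G → ℝ) (x : G) : ℝ :=
  ∑ k ∈ Finset.range n, fourierCoeff f k * walsh k x

/-- The `k`-th Walsh-Fourier coefficient of a martingale, `lim_n ∫ F_n w_k`
(for a dyadic martingale the sequence is eventually constant). -/
def martFourierCoeff (F : ℕ → G → ℝ) (k : ℕ) : ℝ :=
  limUnder atTop (fun n : ℕ => ∫ x, F n x * walsh k x ∂haar)

/-- The `n`-th partial sum of the Walsh-Fourier series of a martingale. -/
def martPartialSum (n : ℕ) (F : ℕ → G → ℝ) (x : G) : ℝ :=
  ∑ k ∈ Finset.range n, martFourierCoeff F k * walsh k x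

/-- The quasi-norm of `L_p(G)`, for functions with values in `[0, ∞]`. -/
def lpQuasiNorm (p : ℝ) (g : G → ℝ≥0∞) : ℝ≥0∞ := (∫⁻ x, g x ^ p ∂haar) ^ (1 / p)

/-- The quasi-norm of weak-`L_p(G)`, for functions with values in `[0, ∞]`:
its `p`-th power is `sup_{t > 0} t ^ p μ(g > t)`. -/
def weakLpNorm (p : ℝ) (g : G → ℝ≥0∞) : ℝ≥0∞ :=
  (⨆ (t : ℝ≥0) (_ : 0 < t), (t : ℝ≥0∞) ^ p * haar {x | (t : ℝ≥0∞) < g x}) ^ (1 / p)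

/-- The maximal function `F^* = sup_n |F_n|` of a martingale. -/
def martMaximal (F : ℕ → G → ℝ) (x : G) : ℝ≥0∞ := ⨆ n : ℕ, ENNReal.ofReal |F n x|

/-- The `H_p` quasi-norm of a martingale. -/
def martHpNorm (p : ℝ) (F : ℕ → G → ℝ) : ℝ≥0∞ := lpQuasiNorm p (martMaximal F)

/-- The martingale Hardy space `H_p(G)`: dyadic martingales whose maximal function is in `L_p`. -/
def MemHp (p : ℝ) (F : ℕ → G → ℝ) : Prop :=
  Martingale F dyadicFiltration haar ∧ martHpNorm p F < ∞

/-- The maximal function of an integrable function,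
`f^*(x) = sup_n μ(I_n(x))⁻¹ |∫_{I_n(x)} f|`. -/
def maximal (f : G → ℝ) (x : G) : ℝ≥0∞ :=
  ⨆ n : ℕ, ENNReal.ofReal |∫ u in interval n x, f u ∂haar| / haar (interval n x)

/-- The `H_p` quasi-norm of an integrable function. -/
def hpNorm (p : ℝ) (f : G → ℝ) : ℝ≥0∞ := lpQuasiNorm p (maximal f)

/-- `p`-atoms: bounded measurable functions `a` for which there is a dyadic interval `I` with
`∫_I a = 0`, `‖a‖_∞ ≤ μ(I)^{-1/p}` and `supp a ⊆ I`. -/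
structure IsAtom (p : ℝ) (a : G → ℝ) : Prop where
  measurable : Measurable a
  bounded : ∃ C : ℝ, ∀ x, |a x| ≤ C
  exists_interval : ∃ (n : ℕ) (x : G),
    ∫ u in interval n x, a u ∂haar = 0 ∧
    eLpNorm a ∞ haar ≤ haar (interval n x) ^ (-(1 / p)) ∧
    Function.support a ⊆ interval n x

end WalshHardy

end

/-!
For a dyadic martingale `F`, Paley's formula `∑_{k < 2 ^ n} w_k(u) w_k(x) = 2 ^ n 1_{I_n(x)}(u)`
gives `S_{2 ^ n} F = F_n`, hence `S_{2 ^ n + 1} F = F_n + F̂(2 ^ n) r_n`. The first term is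
dominated by the maximal function. The second has constant modulus `|F̂(2 ^ n)| ≤ ‖F_{n + 1}‖₁`,
and since `F_{n + 1}` is constant on the dyadic intervals of order `n + 1`, whose measure is
`2 ^ (-(n + 1))`, its `L₁` norm is at most `2 ^ ((n + 1) (1 / p - 1)) ‖F_{n + 1}‖_p`
(`lintegral_le_lpQuasiNorm`). The weighted maximal operator is therefore bounded by
`F^* + c ‖F‖_{H_p}` pointwise (`iSup_martPartialSum_le`), and Chebyshev's inequality, on a space
of measure one, gives the weak-type inequality.

For the sharpness take the atoms `2 ^ (n / p) r_n 1_{I_n(0)}` (`rademacherAtom`). Their maximal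
function is `2 ^ (n / p) 1_{I_n(0)}`, so that their `H_p` quasi-norm is one, while
`S_{2 ^ n + 1}` maps them to `2 ^ (n (1 / p - 1)) r_n`, a function of constant modulus. The
ratio in question is thus at least `2 ^ (n (1 / p - 1)) / φ(2 ^ n + 1)`, which is unbounded by
assumption.
-/

namespace WalshHardy

/-! ### The measure of dyadic intervals and translation invariance -/

instance isProbabilityMeasure_uniformOn_zmod_two :
    IsProbabilityMeasure (ProbabilityTheory.uniformOn (Set.univ : Set (ZMod 2))) :=
  ProbabilityTheory.isProbabilityMeasure_uniformOn Set.finite_univ Set.univ_nonempty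

instance isProbabilityMeasure_haar : IsProbabilityMeasure haar := by
  unfold haar; infer_instance

lemma mem_interval_self (n : ℕ) (x : G) : x ∈ interval n x := fun _ _ => rfl

lemma haar_interval (n : ℕ) (x : G) : haar (interval n x) = (2 : ℝ≥0∞)⁻¹ ^ n := by
  have h : interval n x = Set.pi (Finset.range n : Set ℕ) (fun i => {x i}) := by
    ext y; simp [interval]
  rw [h, haar, Measure.infinitePi_pi _ (fun i _ => measurableSet_singleton _)]
  simp [ProbabilityTheory.uniformOn_univ]

lemma measureReal_haar_interval (n : ℕ) (x : G) : haar.real (interval n x) = ((2 : ℝ) ^ n)⁻¹ := by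
  simp [Measure.real, haar_interval]

lemma measurePreserving_add_right_haar (a : G) : MeasurePreserving (· + a) haar haar := by
  refine ⟨by fun_prop, ?_⟩
  have hmap : ∀ i : ℕ, (ProbabilityTheory.uniformOn (Set.univ : Set (ZMod 2))).map (· + a i) =
      ProbabilityTheory.uniformOn Set.univ := by
    intro i
    ext s hs
    rw [Measure.map_apply (measurable_of_countable _) hs, ProbabilityTheory.uniformOn_univ,
      ProbabilityTheory.uniformOn_univ, ← Measure.map_apply (measurable_of_countable _) hs]
    rw [map_add_right_eq_self]
  have h := Measure.infinitePi_map_pi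
    (μ := fun _ : ℕ => ProbabilityTheory.uniformOn (Set.univ : Set (ZMod 2)))
    (f := fun i z => z + a i) (fun i => measurable_of_countable _)
  simp only [hmap] at h
  exact h

/-- The integral of a function that changes sign under a translation vanishes. -/
lemma integral_eq_zero_of_translate_eq_neg {f : G → ℝ} (a : G) (hf : ∀ x, f (x + a) = -f x) :
    ∫ x, f x ∂haar = 0 := by
  have h := (measurePreserving_add_right_haar a).integral_comp
    (MeasurableEquiv.addRight a).measurableEmbedding f
  simp only [hf, integral_neg] at h
  linarith

/-! ### Measurability with respect to the dyadic filtration -/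

/-- A set in `ζ_n` is a union of dyadic intervals of order `n`. -/
lemma mem_iff_of_measurableSet_dyadicFiltration {n : ℕ} {s : Set G}
    (hs : MeasurableSet[dyadicFiltration n] s) {x y : G} (h : y ∈ interval n x) :
    y ∈ s ↔ x ∈ s := by
  induction s, hs using MeasurableSpace.generateFrom_induction with
  | hC t ht _ =>
    obtain ⟨z, rfl⟩ := ht
    exact forall₂_congr fun i hi => by rw [h i hi]
  | empty => simp
  | compl t _ ih => exact not_congr ih
  | iUnion t _ ih => simp only [Set.mem_iUnion, ih]

lemma eq_of_stronglyMeasurable_dyadicFiltration {n : ℕ} {f : G → ℝ}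
    (hf : StronglyMeasurable[dyadicFiltration n] f) {x y : G} (h : y ∈ interval n x) :
    f y = f x :=
  (mem_iff_of_measurableSet_dyadicFiltration
    (hf.measurable (measurableSet_singleton (f x))) h).2 rfl

/-- A function that is constant on the dyadic intervals of order `n` is `ζ_n`-measurable. -/
lemma stronglyMeasurable_dyadicFiltration {n : ℕ} {f : G → ℝ}
    (hf : ∀ x, ∀ y ∈ interval n x, f y = f x) : StronglyMeasurable[dyadicFiltration n] f := by
  refine @Measurable.stronglyMeasurable G ℝ f (dyadicFiltration n) _ _ _ _ _ fun s _ => ?_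
  have h : f ⁻¹' s = ⋃₀ (interval n '' (f ⁻¹' s)) := by
    ext y
    simp only [Set.mem_sUnion, Set.mem_image, exists_exists_and_eq_and]
    refine ⟨fun hy => ⟨y, hy, mem_interval_self n y⟩, ?_⟩
    rintro ⟨z, hz, hyz⟩
    rwa [Set.mem_preimage, hf z y hyz]
  rw [h]
  refine MeasurableSet.sUnion
    ((finite_range_interval n).subset (Set.image_subset_range _ _)).countable ?_
  rintro _ ⟨z, -, rfl⟩
  exact MeasurableSpace.measurableSet_generateFrom ⟨z, rfl⟩

/-! ### Walsh functions and the Walsh–Dirichlet kernel -/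

lemma rademacher_eq_or (k : ℕ) (x : G) : rademacher k x = 1 ∨ rademacher k x = -1 :=
  neg_one_pow_eq_or ℝ _

lemma abs_rademacher (k : ℕ) (x : G) : |rademacher k x| = 1 := by
  rcases rademacher_eq_or k x with h | h <;> simp [h]

lemma measurable_rademacher (k : ℕ) : Measurable (rademacher k) :=
  (measurable_of_countable fun z : ZMod 2 => (-1 : ℝ) ^ z.val).comp (measurable_pi_apply k)

lemma zmod_two_eq_or (z : ZMod 2) : z = 0 ∨ z = 1 := by
  revert z; decide

lemma rademacher_add_single (k : ℕ) (x : G) :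
    rademacher k (x + Pi.single k 1) = -rademacher k x := by
  have h : ∀ z : ZMod 2, (-1 : ℝ) ^ (z + 1).val = -(-1) ^ z.val := by
    intro z
    have h2 : (1 + 1 : ZMod 2) = 0 := by decide
    rcases zmod_two_eq_or z with rfl | rfl <;> simp [h2, ZMod.val_one]
  simpa [rademacher] using h (x k)

lemma one_add_rademacher_mul (k : ℕ) (u x : G) :
    1 + rademacher k u * rademacher k x = if u k = x k then 2 else 0 := by
  have h : ∀ z w : ZMod 2, (1 : ℝ) + (-1) ^ z.val * (-1) ^ w.val = if z = w then 2 else 0 := by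
    intro z w
    rcases zmod_two_eq_or z with rfl | rfl <;> rcases zmod_two_eq_or w with rfl | rfl <;>
      norm_num [ZMod.val_one]
  exact h (u k) (x k)

lemma walsh_eq_prod_range {n k : ℕ} (hk : k < 2 ^ n) (x : G) :
    walsh k x = ∏ j ∈ Finset.range n, rademacher j x ^ (k.testBit j).toNat := by
  refine Finset.prod_subset (Finset.range_mono (Nat.size_le.2 hk)) fun j _ hj => ?_
  have hj' : k.size ≤ j := by simpa using hj
  rw [Nat.testBit_lt_two_pow (Nat.size_le.1 hj')]
  simp

lemma walsh_two_pow_add {n k : ℕ} (hk : k < 2 ^ n) (x : G) :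
    walsh (2 ^ n + k) x = walsh k x * rademacher n x := by
  have h : 2 ^ n + k < 2 ^ (n + 1) := by rw [pow_succ]; omega
  rw [walsh_eq_prod_range h, walsh_eq_prod_range hk, Finset.prod_range_succ,
    Nat.testBit_two_pow_add_eq, Nat.testBit_lt_two_pow hk]
  congr 1
  · refine Finset.prod_congr rfl fun j hj => ?_
    rw [Nat.testBit_two_pow_add_gt (Finset.mem_range.1 hj)]
  · simp

lemma walsh_zero (x : G) : walsh 0 x = 1 := by simp [walsh]

lemma walsh_two_pow (n : ℕ) (x : G) : walsh (2 ^ n) x = rademacher n x := by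
  simpa [walsh_zero] using walsh_two_pow_add (Nat.two_pow_pos n) x

lemma abs_walsh (k : ℕ) (x : G) : |walsh k x| = 1 := by
  simp [walsh, Finset.abs_prod, abs_pow, abs_rademacher]

lemma measurable_walsh (k : ℕ) : Measurable (walsh k) :=
  Finset.measurable_prod _ fun j _ => (measurable_rademacher j).pow_const _

lemma walsh_eq_of_mem_interval {n k : ℕ} (hk : k < 2 ^ n) {x y : G} (h : y ∈ interval n x) :
    walsh k y = walsh k x := by
  rw [walsh_eq_prod_range hk, walsh_eq_prod_range hk]
  refine Finset.prod_congr rfl fun j hj => ?_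
  rw [rademacher, rademacher, h j (Finset.mem_range.1 hj)]

lemma integrable_mul_walsh {f : G → ℝ} (hf : Integrable f haar) (k : ℕ) :
    Integrable (fun x => f x * walsh k x) haar :=
  hf.mul_bdd (c := 1) (measurable_walsh k).aestronglyMeasurable
    (ae_of_all _ fun x => (abs_walsh k x).le)

/-- The Walsh–Dirichlet kernel of order `2 ^ n` as a product. -/
lemma sum_walsh_mul_walsh (n : ℕ) (u x : G) :
    ∑ k ∈ Finset.range (2 ^ n), walsh k u * walsh k x =
      ∏ j ∈ Finset.range n, (1 + rademacher j u * rademacher j x) := by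
  induction n with
  | zero => simp [walsh_zero]
  | succ n ih =>
    rw [Finset.prod_range_succ, ← ih, pow_succ, mul_two, Finset.sum_range_add, mul_add, mul_one,
      Finset.sum_mul]
    congr 1
    refine Finset.sum_congr rfl fun k hk => ?_
    rw [walsh_two_pow_add (Finset.mem_range.1 hk), walsh_two_pow_add (Finset.mem_range.1 hk)]
    ring

/-- Paley's formula: the Walsh–Dirichlet kernel of order `2 ^ n` is `2 ^ n` on the dyadic interval
of order `n` and vanishes outside. -/
lemma sum_walsh_mul_walsh_eq_indicator (n : ℕ) (u x : G) :
    ∑ k ∈ Finset.range (2 ^ n), walsh k u * walsh k x =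
      (interval n x).indicator (fun _ => (2 : ℝ) ^ n) u := by
  rw [sum_walsh_mul_walsh]
  by_cases h : u ∈ interval n x
  · rw [Set.indicator_of_mem h, Finset.prod_congr rfl fun j hj =>
      (one_add_rademacher_mul j u x).trans (if_pos (h j (Finset.mem_range.1 hj)))]
    simp
  · rw [Set.indicator_of_notMem h]
    obtain ⟨j, hj, hne⟩ : ∃ j < n, u j ≠ x j := by simpa [interval] using h
    exact Finset.prod_eq_zero (Finset.mem_range.2 hj)
      ((one_add_rademacher_mul j u x).trans (if_neg hne))

/-- The partial sums of order `2 ^ n` are the averages over the dyadic intervals of order `n`. -/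
lemma partialSum_two_pow {f : G → ℝ} (hf : Integrable f haar) (n : ℕ) (x : G) :
    partialSum (2 ^ n) f x = (2 : ℝ) ^ n * ∫ u in interval n x, f u ∂haar := by
  calc partialSum (2 ^ n) f x
      = ∑ k ∈ Finset.range (2 ^ n), ∫ u, f u * walsh k u * walsh k x ∂haar := by
        simp only [partialSum, fourierCoeff, integral_mul_const]
    _ = ∫ u, (interval n x).indicator (fun u => (2 : ℝ) ^ n * f u) u ∂haar := by
        rw [← integral_finsetSum _ fun k _ => (integrable_mul_walsh hf k).mul_const _]
        refine integral_congr_ae (ae_of_all _ fun u => ?_)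
        have h := sum_walsh_mul_walsh_eq_indicator n u x
        simp only [mul_assoc, ← Finset.mul_sum, h]
        by_cases hu : u ∈ interval n x <;> simp [hu, mul_comm]
    _ = _ := by
        rw [integral_indicator (measurableSet_interval n x), integral_const_mul]

/-! ### Fourier coefficients and partial sums of martingales -/

/-- The limit defining the `k`-th coefficient is attained at every `n` with `k < 2 ^ n`. -/
lemma martFourierCoeff_eq {F : ℕ → G → ℝ} (hF : Martingale F dyadicFiltration haar) {n k : ℕ}
    (hk : k < 2 ^ n) : martFourierCoeff F k = fourierCoeff (F n) k := by
  refine Tendsto.limUnder_eq (tendsto_const_nhds.congr' ?_)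
  filter_upwards [eventually_ge_atTop n] with m hm
  have hw : StronglyMeasurable[dyadicFiltration n] (walsh k) :=
    stronglyMeasurable_dyadicFiltration fun x y h => walsh_eq_of_mem_interval hk h
  have h1 := condExp_mul_of_stronglyMeasurable_right (μ := haar) hw
    (integrable_mul_walsh (hF.integrable m) k) (hF.integrable m)
  calc fourierCoeff (F n) k
      = ∫ x, (haar[F m * walsh k | dyadicFiltration n]) x ∂haar := by
        refine integral_congr_ae ?_
        filter_upwards [h1, hF.condExp_ae_eq hm] with x hx hx'
        rw [hx, Pi.mul_apply, hx']
    _ = ∫ x, F m x * walsh k x ∂haar := integral_condExp (dyadicFiltration.le n)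

lemma martPartialSum_two_pow {F : ℕ → G → ℝ} (hF : Martingale F dyadicFiltration haar) (n : ℕ)
    (x : G) : martPartialSum (2 ^ n) F x = F n x := by
  have h : martPartialSum (2 ^ n) F x = partialSum (2 ^ n) (F n) x :=
    Finset.sum_congr rfl fun k hk => by rw [martFourierCoeff_eq hF (Finset.mem_range.1 hk)]
  rw [h, partialSum_two_pow (hF.integrable n),
    setIntegral_congr_fun (g := fun _ => F n x) (measurableSet_interval n x) fun y hy =>
      eq_of_stronglyMeasurable_dyadicFiltration (hF.1 n) hy,
    setIntegral_const, measureReal_haar_interval, smul_eq_mul, mul_inv_cancel_left₀ (by positivity)]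

lemma martPartialSum_two_pow_add_one {F : ℕ → G → ℝ} (hF : Martingale F dyadicFiltration haar)
    (n : ℕ) (x : G) :
    martPartialSum (2 ^ n + 1) F x = F n x + martFourierCoeff F (2 ^ n) * rademacher n x := by
  rw [← martPartialSum_two_pow hF, ← walsh_two_pow]
  exact Finset.sum_range_succ _ _

/-! ### The weak-type inequality -/

lemma weakLpNorm_mono {p : ℝ} (hp : 0 < p) {g h : G → ℝ≥0∞} (hgh : ∀ x, g x ≤ h x) :
    weakLpNorm p g ≤ weakLpNorm p h := by
  refine ENNReal.rpow_le_rpow (iSup₂_mono fun t _ => ?_) (by positivity)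
  gcongr with x
  exact hgh x

/-- Chebyshev's inequality. -/
lemma weakLpNorm_le_lpQuasiNorm {p : ℝ} (hp : 0 < p) {g : G → ℝ≥0∞} (hg : Measurable g) :
    weakLpNorm p g ≤ lpQuasiNorm p g := by
  refine ENNReal.rpow_le_rpow (iSup₂_le fun t _ => ?_) (by positivity)
  refine le_trans ?_ (mul_meas_ge_le_lintegral (μ := haar) (hg.pow_const p) ((t : ℝ≥0∞) ^ p))
  gcongr with x
  intro h
  exact ENNReal.rpow_le_rpow h.le hp.le

lemma measurable_martMaximal {F : ℕ → G → ℝ} (hF : Martingale F dyadicFiltration haar) :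
    Measurable (martMaximal F) :=
  Measurable.iSup fun n =>
    ((hF.1 n).mono (dyadicFiltration.le n)).measurable.abs.ennreal_ofReal

lemma lpQuasiNorm_rpow {p : ℝ} (hp : 0 < p) (g : G → ℝ≥0∞) :
    lpQuasiNorm p g ^ p = ∫⁻ x, g x ^ p ∂haar := by
  rw [lpQuasiNorm, one_div, ENNReal.rpow_inv_rpow hp.ne']

/-- For `p < 1` a function that is constant on the dyadic intervals of order `m` satisfies
`‖g‖₁ ≤ 2 ^ (m (1 / p - 1)) ‖g‖_p`: each value is at most `2 ^ (m / p) ‖g‖_p`, since it is taken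
on a set of measure `2 ^ (-m)`, and `g = g ^ p * g ^ (1 - p)`. -/
lemma lintegral_le_lpQuasiNorm {p : ℝ} (hp0 : 0 < p) (hp1 : p < 1) {m : ℕ} {g : G → ℝ≥0∞}
    (hgm : Measurable g) (hg : ∀ x, ∀ y ∈ interval m x, g y = g x) :
    ∫⁻ x, g x ∂haar ≤ (2 : ℝ≥0∞) ^ ((m : ℝ) * (1 / p - 1)) * lpQuasiNorm p g := by
  set M := lpQuasiNorm p g
  have hM : ∫⁻ x, g x ^ p ∂haar = M ^ p := (lpQuasiNorm_rpow hp0 g).symm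
  have hval : ∀ x, g x ^ p ≤ (2 : ℝ≥0∞) ^ m * M ^ p := by
    intro x
    have h : g x ^ p * (2 : ℝ≥0∞)⁻¹ ^ m ≤ M ^ p := by
      rw [← haar_interval m x, ← hM, ← setLIntegral_const]
      calc ∫⁻ _ in interval m x, g x ^ p ∂haar = ∫⁻ y in interval m x, g y ^ p ∂haar :=
            setLIntegral_congr_fun (measurableSet_interval m x) fun y hy => by
              simp only [hg x y hy]
        _ ≤ _ := setLIntegral_le_lintegral _ _
    calc g x ^ p = (2 : ℝ≥0∞) ^ m * (g x ^ p * (2 : ℝ≥0∞)⁻¹ ^ m) := by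
          rw [mul_left_comm, ← mul_pow, ENNReal.mul_inv_cancel (by simp) (by simp), one_pow,
            mul_one]
      _ ≤ _ := by gcongr
  have hexp : p * ((1 - p) / p) = 1 - p := by field_simp
  have hexp' : 0 ≤ (1 - p) / p := div_nonneg (by linarith) hp0.le
  calc ∫⁻ x, g x ∂haar
      ≤ ∫⁻ x, g x ^ p * ((2 : ℝ≥0∞) ^ m * M ^ p) ^ ((1 - p) / p) ∂haar := by
        refine lintegral_mono fun x => ?_
        calc g x = g x ^ p * (g x ^ p) ^ ((1 - p) / p) := by
              rw [← ENNReal.rpow_mul, hexp, ← ENNReal.rpow_add_of_nonneg _ _ hp0.le (by linarith)]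
              simp
          _ ≤ _ := by gcongr; exact hval x
    _ = (∫⁻ x, g x ^ p ∂haar) * ((2 : ℝ≥0∞) ^ m * M ^ p) ^ ((1 - p) / p) :=
        lintegral_mul_const _ (hgm.pow_const p)
    _ = (2 : ℝ≥0∞) ^ ((m : ℝ) * (1 / p - 1)) * M := by
        rw [hM, ENNReal.mul_rpow_of_nonneg _ _ hexp', ← ENNReal.rpow_mul, hexp, mul_left_comm,
          ← ENNReal.rpow_add_of_nonneg _ _ hp0.le (by linarith), ← ENNReal.rpow_natCast,
          ← ENNReal.rpow_mul]
        rw [add_sub_cancel, ENNReal.rpow_one, sub_div, div_self hp0.ne']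

/-- The growth of the Fourier coefficients of an `H_p` martingale along the powers of two. -/
lemma ofReal_abs_martFourierCoeff_two_pow_le {p : ℝ} (hp0 : 0 < p) (hp1 : p < 1)
    {F : ℕ → G → ℝ} (hF : Martingale F dyadicFiltration haar) (n : ℕ) :
    ENNReal.ofReal |martFourierCoeff F (2 ^ n)| ≤
      (2 : ℝ≥0∞) ^ (((n + 1 : ℕ) : ℝ) * (1 / p - 1)) * martHpNorm p F := by
  rw [martFourierCoeff_eq hF (n := n + 1) (Nat.pow_lt_pow_right one_lt_two n.lt_succ_self)]
  calc ENNReal.ofReal |fourierCoeff (F (n + 1)) (2 ^ n)|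
      ≤ ∫⁻ x, ENNReal.ofReal |F (n + 1) x| ∂haar := by
        have h := enorm_integral_le_lintegral_enorm (μ := haar)
          fun x => F (n + 1) x * walsh (2 ^ n) x
        simpa only [fourierCoeff, Real.enorm_eq_ofReal_abs, abs_mul, abs_walsh, mul_one] using h
    _ ≤ (2 : ℝ≥0∞) ^ (((n + 1 : ℕ) : ℝ) * (1 / p - 1)) *
          lpQuasiNorm p fun x => ENNReal.ofReal |F (n + 1) x| :=
        lintegral_le_lpQuasiNorm hp0 hp1
          ((hF.1 (n + 1)).mono (dyadicFiltration.le _)).measurable.abs.ennreal_ofReal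
          fun x y hy => by rw [eq_of_stronglyMeasurable_dyadicFiltration (hF.1 (n + 1)) hy]
    _ ≤ _ := by
        gcongr
        refine ENNReal.rpow_le_rpow (lintegral_mono fun x => ?_) (by positivity)
        exact ENNReal.rpow_le_rpow (le_iSup (fun n => ENNReal.ofReal |F n x|) (n + 1)) hp0.le

/-- After division by the weight, the partial sums of order `2 ^ n + 1` are dominated by the
maximal function plus a constant. -/
lemma iSup_martPartialSum_le {p : ℝ} (hp0 : 0 < p) (hp1 : p < 1)
    {F : ℕ → G → ℝ} (hF : Martingale F dyadicFiltration haar) (x : G) :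
    ⨆ n : ℕ, ENNReal.ofReal
        (|martPartialSum (2 ^ n + 1) F x| / (2 : ℝ) ^ ((n : ℝ) * (1 / p - 1))) ≤
      martMaximal F x + (2 : ℝ≥0∞) ^ (1 / p - 1) * martHpNorm p F := by
  have hexp : 0 ≤ 1 / p - 1 := by
    rw [sub_nonneg, le_div_iff₀ hp0]; linarith
  refine iSup_le fun n => ?_
  set W : ℝ := (2 : ℝ) ^ ((n : ℝ) * (1 / p - 1)) with hW
  have hW1 : 1 ≤ W := Real.one_le_rpow one_le_two (by positivity)
  have hW0 : 0 < W := by linarith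
  have hWE : (2 : ℝ≥0∞) ^ ((n : ℝ) * (1 / p - 1)) = ENNReal.ofReal W := by
    rw [hW, ← ENNReal.ofReal_rpow_of_pos two_pos, ENNReal.ofReal_ofNat]
  have hle : |martPartialSum (2 ^ n + 1) F x| / W ≤
      |F n x| + |martFourierCoeff F (2 ^ n)| / W := by
    rw [martPartialSum_two_pow_add_one hF]
    calc _ ≤ (|F n x| + |martFourierCoeff F (2 ^ n)|) / W := by
          gcongr
          refine (abs_add_le _ _).trans_eq ?_
          rw [abs_mul, abs_rademacher, mul_one]
      _ ≤ _ := by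
          rw [add_div]
          gcongr
          exact div_le_self (abs_nonneg _) hW1
  refine (ENNReal.ofReal_le_ofReal hle).trans ?_
  rw [ENNReal.ofReal_add (abs_nonneg _) (by positivity)]
  gcongr
  · exact le_iSup (fun n => ENNReal.ofReal |F n x|) n
  · rw [ENNReal.ofReal_div_of_pos hW0]
    refine ENNReal.div_le_of_le_mul' ?_
    refine (ofReal_abs_martFourierCoeff_two_pow_le hp0 hp1 hF n).trans_eq ?_
    rw [← hWE, ← mul_assoc, ← ENNReal.rpow_add _ _ (by simp) (by simp)]
    congr 2
    push_cast
    ring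

lemma lpQuasiNorm_add_const_le {p : ℝ} (hp0 : 0 < p) (hp1 : p ≤ 1) {g : G → ℝ≥0∞}
    (hg : Measurable g) (c : ℝ≥0∞) :
    lpQuasiNorm p (fun x => g x + c) ≤ (lpQuasiNorm p g ^ p + c ^ p) ^ (1 / p) := by
  refine ENNReal.rpow_le_rpow ?_ (by positivity)
  rw [lpQuasiNorm_rpow hp0]
  calc ∫⁻ x, (g x + c) ^ p ∂haar ≤ ∫⁻ x, (g x ^ p + c ^ p) ∂haar :=
        lintegral_mono fun x => ENNReal.rpow_add_le_add_rpow _ _ hp0.le hp1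
    _ = _ := by
        rw [lintegral_add_left (hg.pow_const p)]
        simp

theorem weakLpNorm_iSup_martPartialSum_le {p : ℝ} (hp0 : 0 < p) (hp1 : p < 1)
    {F : ℕ → G → ℝ} (hF : Martingale F dyadicFiltration haar) :
    weakLpNorm p (fun x => ⨆ n : ℕ, ENNReal.ofReal
        (|martPartialSum (2 ^ n + 1) F x| / (2 : ℝ) ^ ((n : ℝ) * (1 / p - 1)))) ≤
      (((1 + (2 ^ (1 / p - 1)) ^ p) ^ (1 / p) : ℝ≥0) : ℝ≥0∞) * martHpNorm p F := by
  have hp' : 0 ≤ 1 / p := by positivity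
  have hexp : 0 ≤ 1 / p - 1 := by
    rw [sub_nonneg, le_div_iff₀ hp0]; linarith
  set M := martHpNorm p F with hM
  calc _ ≤ weakLpNorm p fun x => martMaximal F x + (2 : ℝ≥0∞) ^ (1 / p - 1) * M :=
        weakLpNorm_mono hp0 fun x => iSup_martPartialSum_le hp0 hp1 hF x
    _ ≤ lpQuasiNorm p fun x => martMaximal F x + (2 : ℝ≥0∞) ^ (1 / p - 1) * M :=
        weakLpNorm_le_lpQuasiNorm hp0 ((measurable_martMaximal hF).add_const _)
    _ ≤ (M ^ p + ((2 : ℝ≥0∞) ^ (1 / p - 1) * M) ^ p) ^ (1 / p) :=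
        lpQuasiNorm_add_const_le hp0 hp1.le (measurable_martMaximal hF) _
    _ = ((1 + ((2 : ℝ≥0∞) ^ (1 / p - 1)) ^ p) * M ^ p) ^ (1 / p) := by
        rw [ENNReal.mul_rpow_of_nonneg _ _ hp0.le, add_mul, one_mul]
    _ = (1 + ((2 : ℝ≥0∞) ^ (1 / p - 1)) ^ p) ^ (1 / p) * M := by
        rw [ENNReal.mul_rpow_of_nonneg _ _ hp', one_div, ENNReal.rpow_rpow_inv hp0.ne']
    _ = _ := by
        rw [ENNReal.coe_rpow_of_nonneg _ hp', ENNReal.coe_add,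
          ENNReal.coe_rpow_of_nonneg _ hp0.le, ENNReal.coe_rpow_of_nonneg _ hexp]
        simp

/-! ### The extremal atoms -/

/-- The atom `2 ^ (n / p) r_n` on the dyadic interval of order `n` around the origin, that is
`2 ^ (n (1 / p - 1)) (D_{2 ^ (n + 1)} - D_{2 ^ n})`, with `D_m` the Walsh–Dirichlet kernels. -/
noncomputable def rademacherAtom (p : ℝ) (n : ℕ) : G → ℝ :=
  (interval n 0).indicator fun x => (2 : ℝ) ^ ((n : ℝ) / p) * rademacher n x

lemma measurable_rademacherAtom (p : ℝ) (n : ℕ) : Measurable (rademacherAtom p n) :=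
  ((measurable_rademacher n).const_mul _).indicator (measurableSet_interval n 0)

lemma abs_rademacherAtom (p : ℝ) (n : ℕ) (x : G) :
    |rademacherAtom p n x| = (interval n 0).indicator (fun _ => (2 : ℝ) ^ ((n : ℝ) / p)) x := by
  by_cases h : x ∈ interval n 0
  · simp only [rademacherAtom, Set.indicator_of_mem h, abs_mul, abs_rademacher, mul_one]
    exact abs_of_pos (by positivity)
  · simp [rademacherAtom, h]

lemma abs_rademacherAtom_le (p : ℝ) (n : ℕ) (x : G) :
    |rademacherAtom p n x| ≤ (2 : ℝ) ^ ((n : ℝ) / p) := by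
  rw [abs_rademacherAtom]
  exact Set.indicator_le_self' (fun _ _ => by positivity) x

lemma integrable_rademacherAtom (p : ℝ) (n : ℕ) : Integrable (rademacherAtom p n) haar :=
  Integrable.of_bound (measurable_rademacherAtom p n).aestronglyMeasurable _
    (ae_of_all _ (abs_rademacherAtom_le p n))

lemma add_single_mem_interval {k n : ℕ} (hk : k ≤ n) (x y : G) :
    y + Pi.single n 1 ∈ interval k x ↔ y ∈ interval k x := by
  refine forall₂_congr fun i hi => ?_
  simp [Pi.single_eq_of_ne (hi.trans_le hk).ne]

lemma setIntegral_rademacherAtom_eq_zero (p : ℝ) {k n : ℕ} (hk : k ≤ n) (x : G) :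
    ∫ u in interval k x, rademacherAtom p n u ∂haar = 0 := by
  rw [← integral_indicator (measurableSet_interval k x)]
  refine integral_eq_zero_of_translate_eq_neg (Pi.single n 1) fun u => ?_
  classical
  simp only [rademacherAtom, Set.indicator_apply, add_single_mem_interval hk,
    add_single_mem_interval le_rfl, rademacher_add_single]
  split_ifs <;> simp

lemma isAtom_rademacherAtom (p : ℝ) (n : ℕ) : IsAtom p (rademacherAtom p n) where
  measurable := measurable_rademacherAtom p n
  bounded := ⟨_, abs_rademacherAtom_le p n⟩
  exists_interval := by
    refine ⟨n, 0, setIntegral_rademacherAtom_eq_zero p le_rfl 0, ?_, Set.support_indicator_subset⟩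
    refine eLpNorm_exponent_top.trans_le (eLpNormEssSup_le_of_ae_enorm_bound
      (ae_of_all _ fun x => ?_))
    rw [Real.enorm_eq_ofReal_abs, haar_interval, ← ENNReal.inv_pow, ENNReal.rpow_neg,
      ENNReal.inv_rpow, inv_inv, ← ENNReal.rpow_natCast, ← ENNReal.rpow_mul, mul_one_div]
    refine (ENNReal.ofReal_le_ofReal (abs_rademacherAtom_le p n x)).trans_eq ?_
    rw [← ENNReal.ofReal_rpow_of_pos two_pos, ENNReal.ofReal_ofNat]

lemma maximal_rademacherAtom (p : ℝ) (n : ℕ) (x : G) :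
    maximal (rademacherAtom p n) x =
      (interval n 0).indicator (fun _ => (2 : ℝ≥0∞) ^ ((n : ℝ) / p)) x := by
  -- Averages of order `k ≤ n` vanish; on dyadic intervals of order `k > n` the atom is constant.
  have h1 : ∀ k, n < k → ENNReal.ofReal |∫ u in interval k x, rademacherAtom p n u ∂haar| /
      haar (interval k x) =
      (interval n 0).indicator (fun _ => (2 : ℝ≥0∞) ^ ((n : ℝ) / p)) x := by
    intro k hk
    have hconst : ∀ y ∈ interval k x, rademacherAtom p n y = rademacherAtom p n x := by
      classical
      intro y hy
      have hmem : y ∈ interval n 0 ↔ x ∈ interval n 0 :=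
        forall₂_congr fun i hi => by rw [hy i (hi.trans hk)]
      simp only [rademacherAtom, Set.indicator_apply, hmem, rademacher, hy n hk]
    rw [setIntegral_congr_fun (measurableSet_interval k x) hconst, setIntegral_const, smul_eq_mul,
      abs_mul, abs_of_nonneg measureReal_nonneg, ENNReal.ofReal_mul measureReal_nonneg,
      ofReal_measureReal, mul_comm, ENNReal.mul_div_cancel_right (by simp [haar_interval])
        (measure_ne_top _ _), abs_rademacherAtom]
    by_cases h : x ∈ interval n 0
    · simp only [Set.indicator_of_mem h]
      rw [← ENNReal.ofReal_rpow_of_pos two_pos, ENNReal.ofReal_ofNat]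
    · simp [h]
  refine le_antisymm (iSup_le fun k => ?_) ?_
  · rcases le_or_gt k n with hk | hk
    · simp [setIntegral_rademacherAtom_eq_zero p hk]
    · exact (h1 k hk).le
  · exact (h1 (n + 1) n.lt_succ_self).symm.le.trans
      (le_iSup (fun k => ENNReal.ofReal |∫ u in interval k x, rademacherAtom p n u ∂haar| /
        haar (interval k x)) (n + 1))

lemma hpNorm_rademacherAtom {p : ℝ} (hp : 0 < p) (n : ℕ) : hpNorm p (rademacherAtom p n) = 1 := by
  have h : ∀ x, maximal (rademacherAtom p n) x ^ p =
      (interval n 0).indicator (fun _ => (2 : ℝ≥0∞) ^ n) x := by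
    intro x
    rw [maximal_rademacherAtom]
    by_cases hx : x ∈ interval n 0
    · simp only [Set.indicator_of_mem hx]
      rw [← ENNReal.rpow_mul, div_mul_cancel₀ _ hp.ne', ENNReal.rpow_natCast]
    · simp [hx, hp]
  rw [hpNorm, lpQuasiNorm, lintegral_congr h,
    lintegral_indicator_const (measurableSet_interval n 0), haar_interval, ← mul_pow,
    ENNReal.mul_inv_cancel (by simp) (by simp), one_pow, ENNReal.one_rpow]

/-- The partial sum of order `2 ^ n` consists of averages of the atom, which vanish, so that only
the term of index `2 ^ n` remains. -/
lemma partialSum_two_pow_add_one_rademacherAtom (p : ℝ) (n : ℕ) (x : G) :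
    partialSum (2 ^ n + 1) (rademacherAtom p n) x =
      (2 : ℝ) ^ ((n : ℝ) * (1 / p - 1)) * rademacher n x := by
  have h0 : partialSum (2 ^ n) (rademacherAtom p n) x = 0 := by
    rw [partialSum_two_pow (integrable_rademacherAtom p n),
      setIntegral_rademacherAtom_eq_zero p le_rfl, mul_zero]
  have h1 : fourierCoeff (rademacherAtom p n) (2 ^ n) = (2 : ℝ) ^ ((n : ℝ) * (1 / p - 1)) := by
    have h : ∀ u, rademacherAtom p n u * walsh (2 ^ n) u =
        (interval n 0).indicator (fun _ => (2 : ℝ) ^ ((n : ℝ) / p)) u := by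
      intro u
      by_cases hu : u ∈ interval n 0
      · simp only [rademacherAtom, walsh_two_pow, Set.indicator_of_mem hu]
        rcases rademacher_eq_or n u with h | h <;> simp [h]
      · simp [rademacherAtom, hu]
    simp only [fourierCoeff, h]
    rw [integral_indicator_const _ (measurableSet_interval n 0), measureReal_haar_interval,
      smul_eq_mul, ← Real.rpow_natCast, ← Real.rpow_neg two_pos.le, ← Real.rpow_add two_pos]
    congr 1
    ring
  rw [partialSum, Finset.sum_range_succ, h1, walsh_two_pow]
  simpa [partialSum] using h0

lemma le_weakLpNorm_const {p : ℝ} (hp : 0 < p) (c : ℝ≥0∞) : c ≤ weakLpNorm p fun _ => c := by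
  refine ENNReal.le_of_forall_nnreal_lt fun t ht => ?_
  rcases eq_or_ne t 0 with rfl | ht0
  · simp
  calc (t : ℝ≥0∞) = ((t : ℝ≥0∞) ^ p) ^ (1 / p) := by
        rw [one_div, ENNReal.rpow_rpow_inv hp.ne']
    _ ≤ _ := by
        refine ENNReal.rpow_le_rpow ?_ (by positivity)
        refine le_trans ?_ (le_iSup₂ t (pos_iff_ne_zero.2 ht0))
        simp [ht]

end WalshHardy

open WalshHardy in
theorem corollary4 (p : ℝ) (hp0 : 0 < p) (hp1 : p < 1) :
    (∃ C : ℝ≥0, ∀ F : ℕ → G → ℝ, MemHp p F →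
      weakLpNorm p (fun x => ⨆ n : ℕ, ENNReal.ofReal
          (|martPartialSum (2 ^ n + 1) F x| / (2 : ℝ) ^ ((n : ℝ) * (1 / p - 1))))
        ≤ C * martHpNorm p F) ∧
    (∀ φ : ℕ → ℝ, (∀ n, 1 ≤ φ n) → Monotone φ →
      limsup (fun n : ℕ => (((2 : ℝ) ^ ((n : ℝ) * (1 / p - 1)) / φ (2 ^ n + 1) : ℝ) : EReal))
        atTop = ⊤ →
      ∃ f : ℕ → G → ℝ, (∀ n, IsAtom p (f n) ∧ hpNorm p (f n) ≠ 0 ∧ hpNorm p (f n) ≠ ∞) ∧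
        ⨆ n : ℕ, weakLpNorm p (fun x => ENNReal.ofReal
            (|partialSum (2 ^ n + 1) (f n) x| / φ (2 ^ n + 1))) / hpNorm p (f n) = ∞) := by
  refine ⟨⟨_, fun F hF => weakLpNorm_iSup_martPartialSum_le hp0 hp1 hF.1⟩,
    fun φ _ _ hlim => ⟨rademacherAtom p, fun n => ⟨isAtom_rademacherAtom p n, ?_, ?_⟩, ?_⟩⟩
  · simp [hpNorm_rademacherAtom hp0]
  · simp [hpNorm_rademacherAtom hp0]
  refine ENNReal.eq_top_of_forall_nnreal_le fun b => ?_
  obtain ⟨n, hn⟩ := (frequently_lt_of_lt_limsup (f := atTop) (b := ((b : ℝ) : EReal))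
    (by isBoundedDefault) (hlim ▸ EReal.coe_lt_top b)).exists
  refine le_trans ?_ (le_iSup _ n)
  have habs : |(2 : ℝ) ^ ((n : ℝ) * (1 / p - 1))| = (2 : ℝ) ^ ((n : ℝ) * (1 / p - 1)) :=
    abs_of_pos (by positivity)
  simp only [hpNorm_rademacherAtom hp0, div_one, partialSum_two_pow_add_one_rademacherAtom, abs_mul,
    abs_rademacher, mul_one, habs]
  refine le_trans ?_ (le_weakLpNorm_const hp0 _)
  rw [← ENNReal.ofReal_coe_nnreal]
  exact ENNReal.ofReal_le_ofReal (EReal.coe_lt_coe_iff.1 hn).le
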